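/- Let $\pi\colon C\to\operatorname{Spec}\mathbb C$ be a smooth algebraic curve over $\mathbb C$, i.e. a scheme with a structure morphism smooth of relative dimension $1$ (for instance a smooth irreducible projective curve), with tangent sheaf $T_C=\mathcal{D}er_{\mathbb C}(\mathcal O_C,\mathcal O_C)$. For an integer $n\ge 1$ let $Z_n=\operatorname{Spec}\mathbb C[t]/(t^n)$, let $\mathcal A_n=\mathcal O_C[t]/(t^n)$ be the structure sheaf of $C\times Z_n$, viewed as a sheaf of $\mathbb C$-algebras on $C$, and let $\mathcal G_n$ be the sheaf of groups on $C$ whose sections over an open $U$ are the automorphisms of the sheaf of $\mathbb C$-algebras $\mathcal A_n|_U$ which commute with the projection $\mathcal A_n|_U\to\mathcal O_U$, $t\mapsto 0$. For $n\geq 2$, every section of $\mathcal G_n$ preserves the ideal $(t^{n-1})=\ker(\mathcal A_n\to\mathcal A_{n-1})$, which defines a morphism of sheaves of groups $\rho_n\colon\mathcal G_n\to\mathcal G_{n-1}$. For an open $U\subseteq C$, a vector field $\sigma\in T_C(U)$ and $\mu,\nu\in\mathcal A_n(U)$ with $\nu$ invertible, write $\phi^\sigma_{\mu\nu}$ for the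 section of $\mathcal G_n$ over $U$, if it exists (it is then unique), given on every open $V\subseteq U$ by $$\phi^\sigma_{\mu\nu}(\alpha)=\sum_{k=0}^{n-1}\frac1{k!}\,\sigma^k(\alpha)\,(\mu t)^k\quad(\alpha\in\mathcal O_C(V)),\qquad \phi^\sigma_{\mu\nu}(t)=\nu t .$$ Let $n\ge 3$. Then the kernel of $\rho_n$ is abelian, and there is a morphism of sheaves of groups $\lambda\colon T_C\oplus\mathcal O_C\to\mathcal G_n$ such that, for every open $U$, every $\sigma\in T_C(U)$ (in particular every generator $\sigma$ of $T_C|_U$) and all $\theta,\beta\in\mathcal O_C(U)$, the automorphism $\phi^\sigma_{\theta t^{n-2},\,1+\beta t^{n-2}}$ exists and $$\lambda(\theta\sigma,\beta)=\phi^\sigma_{\theta t^{n-2},\,1+\beta t^{n-2}} ,$$ and such that $\lambda$ is an isomorphism of sheaves of groups of $T_C\oplus\mathcal O_C$ onto $\ker(\rho_n)$. Moreover $\rho_n$ is surjective as a morphism of sheaves (i.e. locally surjective), so that one has an exact sequence of sheaves of groups $$0\longrightarrow T_C\oplus\mathcal O_C\xrightarrow{\ \lambda\ }\mathcal G_n\xrightarrow{\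 \rho_n\ }\mathcal G_{n-1}\longrightarrow 0 .$$ -/

import Mathlib

open CategoryTheory AlgebraicGeometry TopologicalSpace Opposite Polynomial

namespace PrimitiveCurves

noncomputable section

variable {C : Scheme.{0}} (π : C ⟶ Spec (CommRingCat.of ℂ))

/-! ### The structure sheaf of a scheme over `ℂ` -/

/-- The sections `𝒪_C(U)`, as a `ℂ`-algebra through the structure morphism `π`. -/
def Reg (_ : C ⟶ Spec (CommRingCat.of ℂ)) (U : C.Opens) : Type := Γ(C, U)

instance (U : C.Opens) : CommRing (Reg π U) := inferInstanceAs (CommRing Γ(C, U))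

/-- The ring homomorphism `ℂ → 𝒪_C(U)` given by the structure morphism `π`. -/
def scalars (U : C.Opens) : ℂ →+* Reg π U :=
  ((Scheme.ΓSpecIso (CommRingCat.of ℂ)).inv ≫ π.appLE ⊤ U le_top).hom

instance (U : C.Opens) : Algebra ℂ (Reg π U) := (scalars π U).toAlgebra

/-- The restriction `𝒪_C(U) → 𝒪_C(V)` for `V ≤ U`, a morphism of `ℂ`-algebras. -/
def res {U V : C.Opens} (h : V ≤ U) : Reg π U →ₐ[ℂ] Reg π V where
  __ := (C.presheaf.map (homOfLE h).op).hom
  commutes' c := by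
    have e : ((Scheme.ΓSpecIso (CommRingCat.of ℂ)).inv ≫ π.appLE ⊤ U le_top) ≫
        C.presheaf.map (homOfLE h).op =
        (Scheme.ΓSpecIso (CommRingCat.of ℂ)).inv ≫ π.appLE ⊤ V le_top := by
      exact (Category.assoc _ _ _).trans (congrArg _ (Scheme.Hom.appLE_map π _ _))
    exact congrArg (fun f ↦ f.hom c) e

theorem res_self {U : C.Opens} (a : Reg π U) : res π le_rfl a = a := by
  have e : C.presheaf.map (homOfLE (le_refl U)).op = 𝟙 _ := C.presheaf.map_id _
  exact congrArg (fun f ↦ f.hom a) e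

theorem res_res {U V W : C.Opens} (h : V ≤ U) (h' : W ≤ V) (a : Reg π U) :
    res π h' (res π h a) = res π (h'.trans h) a := by
  have e : C.presheaf.map (homOfLE h).op ≫ C.presheaf.map (homOfLE h').op =
      C.presheaf.map (homOfLE (h'.trans h)).op := (C.presheaf.map_comp _ _).symm
  exact congrArg (fun f ↦ f.hom a) e

theorem reg_ext {ι : Type} {V : C.Opens} (W : ι → C.Opens) (le : ∀ i, W i ≤ V)
    (cov : V ≤ iSup W) {a b : Reg π V} (h : ∀ i, res π (le i) a = res π (le i) b) : a = b :=
  C.sheaf.eq_of_locally_eq' W V (fun i ↦ homOfLE (le i)) cov a b h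

theorem reg_glue {ι : Type} {V : C.Opens} (W : ι → C.Opens) (le : ∀ i, W i ≤ V)
    (cov : V ≤ iSup W) (s : ∀ i, Reg π (W i))
    (hs : ∀ i j Z (hi : Z ≤ W i) (hj : Z ≤ W j), res π hi (s i) = res π hj (s j)) :
    ∃ a : Reg π V, ∀ i, res π (le i) a = s i :=
  (C.sheaf.existsUnique_gluing' W V (fun i ↦ homOfLE (le i)) cov s
    (fun i j ↦ hs i j _ inf_le_left inf_le_right)).exists

/-! ### The sheaf of algebras `𝒜_n` of `C × Spec ℂ[t]/(t^n)` -/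

/-- `𝒜_n(U) = 𝒪_C(U)[t]/(t^n)`. -/
abbrev A (n : ℕ) (U : C.Opens) : Type := AdjoinRoot (X ^ n : (Reg π U)[X])

/-- The class of `t` in `𝒜_n(U)`. -/
abbrev t (n : ℕ) (U : C.Opens) : A π n U := AdjoinRoot.root _

/-- The inclusion `𝒪_C(U) → 𝒜_n(U)`. -/
abbrev incl (n : ℕ) (U : C.Opens) : Reg π U →+* A π n U := AdjoinRoot.of _

/-- The restriction `𝒜_n(U) → 𝒜_n(V)` for `V ≤ U`. -/
def resA (n : ℕ) {U V : C.Opens} (h : V ≤ U) : A π n U →ₐ[ℂ] A π n V :=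
  AdjoinRoot.mapAlgHom (res π h) _ _ (by simp)

/-- The truncation `𝒜_n(U) → 𝒜_m(U)` for `m ≤ n`. -/
def trunc {m n : ℕ} (h : m ≤ n) (U : C.Opens) : A π n U →ₐ[ℂ] A π m U :=
  AdjoinRoot.mapAlgHom (AlgHom.id ℂ _) _ _ (by simpa using pow_dvd_pow _ h)

section lemmas

variable {π} {n : ℕ} {U V W : C.Opens}

@[simp] theorem resA_incl (h : V ≤ U) (a : Reg π U) :
    resA π n h (incl π n U a) = incl π n V (res π h a) := by simp [resA]

@[simp] theorem resA_t (h : V ≤ U) : resA π n h (t π n U) = t π n V := by simp [resA]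

@[simp] theorem trunc_incl {m : ℕ} (h : m ≤ n) (a : Reg π U) :
    trunc π h U (incl π n U a) = incl π m U a := by simp [trunc]

@[simp] theorem trunc_t {m : ℕ} (h : m ≤ n) : trunc π h U (t π n U) = t π m U := by simp [trunc]

theorem t_pow : t π n U ^ n = 0 := by
  have := AdjoinRoot.eval₂_root (X ^ n : (Reg π U)[X])
  simpa using this

/-- Two ring homomorphisms on `𝒜_n(U)` agree when they agree on `𝒪_C(U)` and at `t`. -/
theorem ringHom_ext {R : Type*} [CommRing R] {f g : A π n U →+* R}
    (h₁ : ∀ a, f (incl π n U a) = g (incl π n U a)) (h₂ : f (t π n U) = g (t π n U)) :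
    f = g := by
  refine Ideal.Quotient.ringHom_ext (Polynomial.ringHom_ext h₁ h₂)

theorem resA_self (a : A π n U) : resA π n le_rfl a = a := by
  have : (resA π n le_rfl : A π n U →ₐ[ℂ] A π n U).toRingHom = RingHom.id _ :=
    ringHom_ext (fun a ↦ by simp [res_self]) (by simp)
  exact congrArg (fun f ↦ f a) this

theorem resA_resA (h : V ≤ U) (h' : W ≤ V) (a : A π n U) :
    resA π n h' (resA π n h a) = resA π n (h'.trans h) a := by
  have : ((resA π n h').comp (resA π n h)).toRingHom = (resA π n (h'.trans h)).toRingHom :=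
    ringHom_ext (fun a ↦ by simp [res_res]) (by simp)
  exact congrArg (fun f ↦ f a) this

theorem trunc_resA {m : ℕ} (hm : m ≤ n) (h : V ≤ U) (a : A π n U) :
    trunc π hm V (resA π n h a) = resA π m h (trunc π hm U a) := by
  have : ((trunc π hm V).comp (resA π n h)).toRingHom =
      ((resA π m h).comp (trunc π hm U)).toRingHom :=
    ringHom_ext (fun a ↦ by simp) (by simp)
  exact congrArg (fun f ↦ f a) this

theorem trunc_surjective {m : ℕ} (hm : m ≤ n) : Function.Surjective (trunc π hm U) := by
  intro a
  obtain ⟨p, rfl⟩ := AdjoinRoot.mk_surjective a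
  refine ⟨AdjoinRoot.mk _ p, ?_⟩
  have : (trunc π hm U).toRingHom.comp (AdjoinRoot.mk _) = AdjoinRoot.mk _ :=
    Polynomial.ringHom_ext (fun a ↦ by simp [trunc]) (by simp [trunc])
  exact congrArg (fun f ↦ f p) this

theorem trunc_eq_zero_iff {m : ℕ} (hm : m ≤ n) (a : A π n U) :
    trunc π hm U a = 0 ↔ a ∈ Ideal.span {t π n U ^ m} := by
  obtain ⟨p, rfl⟩ := AdjoinRoot.mk_surjective a
  have : (trunc π hm U).toRingHom.comp (AdjoinRoot.mk _) = AdjoinRoot.mk _ :=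
    Polynomial.ringHom_ext (fun a ↦ by simp [trunc]) (by simp [trunc])
  have h1 : trunc π hm U (AdjoinRoot.mk _ p) = AdjoinRoot.mk _ p := congrArg (fun f ↦ f p) this
  rw [h1]
  constructor
  · intro h
    obtain ⟨q, rfl⟩ := AdjoinRoot.mk_eq_zero.1 h
    rw [Ideal.mem_span_singleton]
    exact ⟨AdjoinRoot.mk _ q, by simp⟩
  · intro h
    obtain ⟨b, hb⟩ := Ideal.mem_span_singleton.1 h
    have h2 := congrArg (trunc π hm U) hb
    rw [h1, map_mul, map_pow, trunc_t, t_pow, zero_mul] at h2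
    exact h2

end lemmas

/-- The projection `𝒜_n(U) → 𝒪_C(U)`, `t ↦ 0`, for `n ≥ 1`. -/
def aug {n : ℕ} (hn : n ≠ 0) (U : C.Opens) : A π n U →ₐ[ℂ] Reg π U :=
  AdjoinRoot.liftAlgHom _ (AlgHom.id ℂ _) 0 (by simp [hn])

section lemmas

variable {π} {n : ℕ} {U V W : C.Opens}

theorem aug_resA (hn : n ≠ 0) (h : V ≤ U) (a : A π n U) :
    aug π hn V (resA π n h a) = res π h (aug π hn U a) := by
  have : ((aug π hn V).comp (resA π n h)).toRingHom =
      ((res π h).comp (aug π hn U)).toRingHom :=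
    ringHom_ext (fun a ↦ by simp [aug]) (by simp [aug])
  exact congrArg (fun f ↦ f a) this

theorem aug_trunc {m : ℕ} (hm : m ≤ n) (hn : n ≠ 0) (hm' : m ≠ 0) (a : A π n U) :
    aug π hm' U (trunc π hm U a) = aug π hn U a := by
  have : ((aug π hm' U).comp (trunc π hm U)).toRingHom = (aug π hn U).toRingHom :=
    ringHom_ext (fun a ↦ by simp [aug]) (by simp [aug])
  exact congrArg (fun f ↦ f a) this

theorem aug_eq_zero_iff (hn : n ≠ 0) (a : A π n U) :
    aug π hn U a = 0 ↔ a ∈ Ideal.span {t π n U} := by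
  constructor
  · intro h
    obtain ⟨p, rfl⟩ := AdjoinRoot.mk_surjective a
    have h' : p.coeff 0 = 0 := by
      rw [aug, AdjoinRoot.liftAlgHom_mk] at h
      rw [coeff_zero_eq_eval_zero, Polynomial.eval]
      exact h
    obtain ⟨q, rfl⟩ := X_dvd_iff.2 h'
    rw [Ideal.mem_span_singleton]
    exact ⟨AdjoinRoot.mk _ q, by simp⟩
  · intro h
    obtain ⟨b, rfl⟩ := Ideal.mem_span_singleton.1 h
    simp [aug]

/-- The coefficient of `t ^ k` of a section of `𝒜_n`. -/
def coef (k : ℕ) (a : A π n U) : Reg π U :=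
  (AdjoinRoot.modByMonicHom (monic_X_pow n) a).coeff k

theorem coef_resA (h : V ≤ U) (k : ℕ) (a : A π n U) :
    coef k (resA π n h a) = res π h (coef k a) := by
  obtain ⟨p, rfl⟩ := AdjoinRoot.mk_surjective a
  have : (resA π n h).toRingHom.comp (AdjoinRoot.mk _) =
      (AdjoinRoot.mk _).comp (mapRingHom (res π h).toRingHom) :=
    Polynomial.ringHom_ext (fun a ↦ by simp [resA]) (by simp [resA])
  have h1 : resA π n h (AdjoinRoot.mk _ p) = AdjoinRoot.mk _ (p.map (res π h).toRingHom) :=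
    congrArg (fun f ↦ f p) this
  have h2 := map_modByMonic (res π h).toRingHom (p := p) (monic_X_pow n)
  rw [Polynomial.map_pow, map_X] at h2
  rw [h1, coef, coef, AdjoinRoot.modByMonicHom_mk, AdjoinRoot.modByMonicHom_mk, ← h2, coeff_map]
  rfl

theorem coef_ext {a b : A π n U} (h : ∀ k, coef k a = coef k b) : a = b :=
  (AdjoinRoot.mk_leftInverse (monic_X_pow n)).injective (Polynomial.ext h)

theorem A_ext {ι : Type} (W : ι → C.Opens) (le : ∀ i, W i ≤ V)
    (cov : V ≤ iSup W) {a b : A π n V} (h : ∀ i, resA π n (le i) a = resA π n (le i) b) :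
    a = b :=
  coef_ext fun k ↦ reg_ext π W le cov fun i ↦ by rw [← coef_resA, ← coef_resA, h]

theorem sum_coef (a : A π n U) :
    ∑ k ∈ Finset.range n, incl π n U (coef k a) * t π n U ^ k = a := by
  conv_rhs => rw [← AdjoinRoot.mk_leftInverse (monic_X_pow n) a]
  rcases subsingleton_or_nontrivial (Reg π U) with hs | hs
  · have := (AdjoinRoot.of (X ^ n : (Reg π U)[X])).codomain_trivial
    exact Subsingleton.elim _ _
  rcases Nat.eq_zero_or_pos n with rfl | hn
  · rw [← mul_one a, ← pow_zero (t π 0 U), t_pow]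
    simp
  have hd : (AdjoinRoot.modByMonicHom (monic_X_pow n) a).natDegree < n := by
    obtain ⟨p, rfl⟩ := AdjoinRoot.mk_surjective a
    rw [AdjoinRoot.modByMonicHom_mk]
    have := natDegree_modByMonic_lt p (monic_X_pow (R := Reg π U) n)
      (fun h ↦ by simpa [hn.ne'] using congrArg natDegree h)
    simpa using this
  conv_rhs => rw [as_sum_range' _ n hd]
  simp [coef, ← C_mul_X_pow_eq_monomial]

theorem A_glue {ι : Type} (W : ι → C.Opens) (le : ∀ i, W i ≤ V)
    (cov : V ≤ iSup W) (s : ∀ i, A π n (W i))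
    (hs : ∀ i j Z (hi : Z ≤ W i) (hj : Z ≤ W j), resA π n hi (s i) = resA π n hj (s j)) :
    ∃ a : A π n V, ∀ i, resA π n (le i) a = s i := by
  have key (k : ℕ) : ∃ a : Reg π V, ∀ i, res π (le i) a = coef k (s i) :=
    reg_glue π W le cov _ fun i j Z hi hj ↦ by rw [← coef_resA, ← coef_resA, hs i j]
  choose c hc using key
  refine ⟨∑ k ∈ Finset.range n, incl π n V (c k) * t π n V ^ k, fun i ↦ ?_⟩
  rw [map_sum, ← sum_coef (s i)]
  exact Finset.sum_congr rfl fun k _ ↦ by rw [map_mul, map_pow, resA_incl, resA_t, hc]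

end lemmas

/-- Gluing of compatible local endomorphisms of a sheaf of sets. -/
theorem glue_end {F : C.Opens → Type} (r : ∀ {U V : C.Opens}, V ≤ U → F U → F V)
    (r_r : ∀ {U V Z : C.Opens} (h : V ≤ U) (h' : Z ≤ V) (a : F U),
      r h' (r h a) = r (h'.trans h) a)
    (_ : ∀ {ι : Type} {V : C.Opens} (W : ι → C.Opens) (le : ∀ i, W i ≤ V) (_ : V ≤ iSup W)
      {a b : F V}, (∀ i, r (le i) a = r (le i) b) → a = b)
    (glue : ∀ {ι : Type} {V : C.Opens} (W : ι → C.Opens) (le : ∀ i, W i ≤ V) (_ : V ≤ iSup W)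
      (s : ∀ i, F (W i)),
      (∀ i j Z (hi : Z ≤ W i) (hj : Z ≤ W j), r hi (s i) = r hj (s j)) →
        ∃ a : F V, ∀ i, r (le i) a = s i)
    {ι : Type} (W : ι → C.Opens) (e : ∀ i Z, Z ≤ W i → F Z → F Z)
    (he : ∀ i Z Z' (h : Z ≤ W i) (h' : Z' ≤ Z) (a : F Z),
      r h' (e i Z h a) = e i Z' (h'.trans h) (r h' a))
    (hc : ∀ i j Z (hi : Z ≤ W i) (hj : Z ≤ W j) (a : F Z), e i Z hi a = e j Z hj a)
    (V : C.Opens) (hV : V ≤ iSup W) :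
    ∃ E : F V → F V, ∀ i Z (hi : Z ≤ W i) (hZ : Z ≤ V) (a : F V),
      r hZ (E a) = e i Z hi (r hZ a) := by
  have cov : V ≤ ⨆ i, V ⊓ W i := by rw [← inf_iSup_eq]; exact le_inf le_rfl hV
  have key (a : F V) : ∃ b : F V, ∀ i, r inf_le_left b =
      e i (V ⊓ W i) inf_le_right (r inf_le_left a) :=
    glue (fun i ↦ V ⊓ W i) (fun i ↦ inf_le_left) cov _ fun i j Z hi hj ↦ by
      rw [he, he, r_r, r_r]; exact hc ..
  choose E hE using key
  refine ⟨E, fun i Z hi hZ a ↦ ?_⟩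
  rw [← r_r (inf_le_left : V ⊓ W i ≤ V) (le_inf hZ hi), hE, he, r_r]

/-! ### The sheaf of groups `𝒢_n` -/

/-- `𝒢_n(U)`: the automorphisms of the sheaf of `ℂ`-algebras `𝒜_n|_U` that are compatible with the
projection `𝒜_n → 𝒪_C`. -/
@[ext]
structure GAut (n : ℕ) (U : C.Opens) : Type where
  /-- the automorphism of `𝒜_n(V)`, for `V ≤ U` -/
  on : ∀ V : C.Opens, V ≤ U → (A π n V ≃ₐ[ℂ] A π n V)
  resA_on : ∀ {V W : C.Opens} (h : V ≤ U) (h' : W ≤ V) (a : A π n V),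
    resA π n h' (on V h a) = on W (h'.trans h) (resA π n h' a)
  aug_on : ∀ {V : C.Opens} (h : V ≤ U) (hn : n ≠ 0) (a : A π n V),
    aug π hn V (on V h a) = aug π hn V a

/-- The group law of `𝒢_n(U)` is the composition of automorphisms. -/
instance (n : ℕ) (U : C.Opens) : Group (GAut π n U) where
  mul g g' :=
    { on V h := (g'.on V h).trans (g.on V h)
      resA_on h h' a := by simp [g.resA_on, g'.resA_on]
      aug_on h hn a := by simp [g.aug_on, g'.aug_on] }
  one := { on V h := AlgEquiv.refl, resA_on _ _ _ := rfl, aug_on _ _ _ := rfl }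
  inv g :=
    { on V h := (g.on V h).symm
      resA_on h h' a := by
        apply (g.on _ (h'.trans h)).injective
        rw [← g.resA_on h h', AlgEquiv.apply_symm_apply, AlgEquiv.apply_symm_apply]
      aug_on h hn a := by rw [← g.aug_on h hn, AlgEquiv.apply_symm_apply] }
  mul_assoc _ _ _ := rfl
  one_mul _ := rfl
  mul_one _ := rfl
  inv_mul_cancel g := by
    refine GAut.ext (funext fun V ↦ funext fun h ↦ AlgEquiv.ext fun a ↦ ?_)
    exact (g.on V h).symm_apply_apply a

section lemmas

variable {π} {n : ℕ} {U V W : C.Opens}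

theorem GAut.ext' {g g' : GAut π n U} (H : ∀ V h a, g.on V h a = g'.on V h a) : g = g' :=
  GAut.ext (funext fun V ↦ funext fun h ↦ AlgEquiv.ext (H V h))

theorem GAut.on_mul (g g' : GAut π n U) (V : C.Opens) (h : V ≤ U) (a : A π n V) :
    (g * g').on V h a = g.on V h (g'.on V h a) := rfl

end lemmas

/-- The restriction `𝒢_n(U) → 𝒢_n(V)` for `V ≤ U`. -/
def GAut.restrict (n : ℕ) {U V : C.Opens} (h : V ≤ U) : GAut π n U →* GAut π n V where
  toFun g :=
    { on W h' := g.on W (h'.trans h)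
      resA_on h' := g.resA_on (h'.trans h)
      aug_on h' := g.aug_on (h'.trans h) }
  map_one' := rfl
  map_mul' _ _ := rfl

/-- `𝒢_n` as a presheaf of groups on `C`. -/
def autPresheaf (n : ℕ) : TopCat.Presheaf GrpCat.{0} C.toPresheafedSpace.carrier where
  obj U := GrpCat.of (GAut π n U.unop)
  map i := GrpCat.ofHom (GAut.restrict π n i.unop.le)
  map_id _ := rfl
  map_comp _ _ := rfl

theorem autPresheaf_isSheaf (n : ℕ) : (autPresheaf π n).IsSheaf := by
  rw [TopCat.Presheaf.isSheaf_iff_isSheafUniqueGluing]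
  intro ι W sf hsf
  let g (i : ι) : GAut π n (W i) := sf i
  have cpt (i j : ι) : GAut.restrict π n inf_le_left (g i) =
      GAut.restrict π n (inf_le_right : W i ⊓ W j ≤ W j) (g j) := hsf i j
  have hc (i j : ι) (Z : C.Opens) (hi : Z ≤ W i) (hj : Z ≤ W j) :
      (g i).on Z hi = (g j).on Z hj :=
    congrArg (fun g : GAut π n (W i ⊓ W j) ↦ g.on Z (le_inf hi hj)) (cpt i j)
  have key := glue_end (F := A π n) (fun h ↦ resA π n h) resA_resA A_ext A_glue W
    (fun i Z h ↦ (g i).on Z h) (fun i Z Z' h h' a ↦ (g i).resA_on h h' a)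
    (fun i j Z hi hj a ↦ by rw [hc i j Z hi hj])
  have key' := glue_end (F := A π n) (fun h ↦ resA π n h) resA_resA A_ext A_glue W
    (fun i Z h ↦ (g i)⁻¹.on Z h) (fun i Z Z' h h' a ↦ (g i)⁻¹.resA_on h h' a)
    (fun i j Z hi hj a ↦ congrArg (fun f ↦ f.symm a) (hc i j Z hi hj))
  choose E hE using key
  choose E' hE' using key'
  have aext {V : C.Opens} (hV : V ≤ iSup W) {a b : A π n V}
      (h : ∀ i Z (_ : Z ≤ W i) (hZ : Z ≤ V), resA π n hZ a = resA π n hZ b) : a = b :=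
    A_ext (fun i ↦ V ⊓ W i) (fun i ↦ inf_le_left)
      (by rw [← inf_iSup_eq]; exact le_inf le_rfl hV) fun i ↦ h i _ inf_le_right _
  let G (V : {V : C.Opens // V ≤ iSup W}) : A π n V.1 ≃ₐ[ℂ] A π n V.1 :=
    { toFun := E V.1 V.2
      invFun := E' V.1 V.2
      left_inv a := aext V.2 fun i Z hi hZ ↦ by
        rw [hE' V.1 V.2 i Z hi hZ, hE V.1 V.2 i Z hi hZ]
        exact ((g i).on Z hi).symm_apply_apply _
      right_inv a := aext V.2 fun i Z hi hZ ↦ by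
        rw [hE V.1 V.2 i Z hi hZ, hE' V.1 V.2 i Z hi hZ]
        exact ((g i).on Z hi).apply_symm_apply _
      map_add' a b := aext V.2 fun i Z hi hZ ↦ by
        rw [map_add, hE V.1 V.2 i Z hi hZ, hE V.1 V.2 i Z hi hZ, hE V.1 V.2 i Z hi hZ,
          map_add, map_add]
      map_mul' a b := aext V.2 fun i Z hi hZ ↦ by
        rw [map_mul, hE V.1 V.2 i Z hi hZ, hE V.1 V.2 i Z hi hZ, hE V.1 V.2 i Z hi hZ,
          map_mul, map_mul]
      commutes' c := aext V.2 fun i Z hi hZ ↦ by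
        rw [hE V.1 V.2 i Z hi hZ, AlgHom.commutes, AlgEquiv.commutes] }
  have hG (V : {V : C.Opens // V ≤ iSup W}) (i : ι) (Z : C.Opens) (hi : Z ≤ W i) (hZ : Z ≤ V.1)
      (a : A π n V.1) : resA π n hZ (G V a) = (g i).on Z hi (resA π n hZ a) :=
    hE V.1 V.2 i Z hi hZ a
  let T : GAut π n (iSup W) :=
    { on V h := G ⟨V, h⟩
      resA_on {V V'} h h' a := aext (h'.trans h) fun i Z hi hZ ↦ by
        rw [resA_resA, hG ⟨V, h⟩ i Z hi, hG ⟨V', h'.trans h⟩ i Z hi, resA_resA]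
      aug_on {V} h hn a := reg_ext π (fun i ↦ V ⊓ W i) (fun i ↦ inf_le_left)
        (by rw [← inf_iSup_eq]; exact le_inf le_rfl h) fun i ↦ by
          rw [← aug_resA, hG ⟨V, h⟩ i _ inf_le_right, GAut.aug_on, aug_resA] }
  refine ⟨T, fun i ↦ ?_, fun s hs ↦ ?_⟩
  · refine GAut.ext' (g := GAut.restrict π n (le_iSup W i) T) (g' := g i) fun V h a ↦ ?_
    have := hG ⟨V, h.trans (le_iSup W i)⟩ i V h le_rfl a
    rwa [resA_self, resA_self] at this
  · let s' : GAut π n (iSup W) := s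
    refine GAut.ext' (g := s') fun V h a ↦ aext h fun i Z hi hZ ↦ ?_
    refine Eq.trans ?_ (hG ⟨V, h⟩ i Z hi hZ a).symm
    rw [s'.resA_on]
    have : GAut.restrict π n (le_iSup W i) s' = g i := hs i
    exact congrArg (fun g : GAut π n (W i) ↦ g.on Z hi (resA π n hZ a)) this

/-- The sheaf of groups `𝒢_n` on `C`. -/
def 𝒢 (n : ℕ) : TopCat.Sheaf GrpCat.{0} C.toPresheafedSpace.carrier :=
  ⟨autPresheaf π n, autPresheaf_isSheaf π n⟩

/-! ### The restriction `ρ : 𝒢_n → 𝒢_m` -/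

theorem GAut.trunc_on {n m : ℕ} (h : m ≤ n) {U V : C.Opens} (g : GAut π n U) (hV : V ≤ U)
    {a : A π n V} (ha : trunc π h V a = 0) : trunc π h V (g.on V hV a) = 0 := by
  rw [trunc_eq_zero_iff] at ha ⊢
  obtain ⟨b, rfl⟩ := Ideal.mem_span_singleton.1 ha
  rw [map_mul, map_pow]
  refine Ideal.mul_mem_right _ _ ?_
  rw [← Ideal.span_singleton_pow]
  rcases eq_or_ne m 0 with rfl | hm
  · simp
  have hn : n ≠ 0 := by omega
  refine Ideal.pow_mem_pow ((aug_eq_zero_iff hn _).1 ?_) m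
  rw [GAut.aug_on, aug_eq_zero_iff]
  exact Ideal.mem_span_singleton_self _

/-- The endomorphism of `𝒜_m(V)` induced by a section of `𝒢_n`, for `m ≤ n`. -/
def GAut.induced {n m : ℕ} (h : m ≤ n) {U : C.Opens} (g : GAut π n U) (V : C.Opens) (hV : V ≤ U) :
    A π m V →ₐ[ℂ] A π m V :=
  (Ideal.Quotient.liftₐ (RingHom.ker (trunc π h V))
    ((trunc π h V).comp (g.on V hV).toAlgHom) fun _ ha ↦ g.trunc_on π h hV ha).comp
      (Ideal.quotientKerAlgEquivOfSurjective (trunc_surjective h)).symm.toAlgHom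

theorem GAut.induced_trunc {n m : ℕ} (h : m ≤ n) {U V : C.Opens} (g : GAut π n U) (hV : V ≤ U)
    (a : A π n V) : g.induced π h V hV (trunc π h V a) = trunc π h V (g.on V hV a) := by
  have : (Ideal.quotientKerAlgEquivOfSurjective (trunc_surjective h)).symm (trunc π h V a) =
      Ideal.Quotient.mk (RingHom.ker (trunc π h V)) a := by
    rw [AlgEquiv.symm_apply_eq]; rfl
  simp only [GAut.induced, AlgHom.comp_apply]
  erw [this]
  rfl

theorem GAut.induced_comp {n m : ℕ} (h : m ≤ n) {U V : C.Opens} (g : GAut π n U) (hV : V ≤ U) :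
    (g.induced π h V hV).comp (g⁻¹.induced π h V hV) = AlgHom.id ℂ _ := by
  refine AlgHom.ext fun a ↦ ?_
  obtain ⟨a, rfl⟩ := trunc_surjective h a
  rw [AlgHom.comp_apply, GAut.induced_trunc, GAut.induced_trunc, ← GAut.on_mul, mul_inv_cancel]
  rfl

/-- The group homomorphism `𝒢_n(U) → 𝒢_m(U)`, for `m ≤ n`: a section of `𝒢_n` preserves the kernel
of `𝒜_n → 𝒜_m`, so it induces a section of `𝒢_m`. -/
def GAut.rho {n m : ℕ} (h : m ≤ n) (U : C.Opens) : GAut π n U →* GAut π m U where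
  toFun g :=
    { on V hV := AlgEquiv.ofAlgHom (g.induced π h V hV) (g⁻¹.induced π h V hV)
        (g.induced_comp π h hV) (by
          have := g⁻¹.induced_comp π h hV
          rwa [inv_inv] at this)
      resA_on {V W} hV h' a := by
        obtain ⟨a, rfl⟩ := trunc_surjective h a
        change resA π m h' (g.induced π h V hV _) = g.induced π h W (h'.trans hV) _
        rw [GAut.induced_trunc, ← trunc_resA, ← trunc_resA, GAut.induced_trunc, GAut.resA_on]
      aug_on {V} hV hm a := by
        obtain ⟨a, rfl⟩ := trunc_surjective h a
        change aug π hm V (g.induced π h V hV _) = _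
        have hn : n ≠ 0 := by omega
        rw [GAut.induced_trunc, aug_trunc h hn, aug_trunc h hn, GAut.aug_on] }
  map_one' := by
    refine GAut.ext' fun V hV a ↦ ?_
    obtain ⟨a, rfl⟩ := trunc_surjective h a
    exact GAut.induced_trunc π h 1 hV a
  map_mul' g g' := by
    refine GAut.ext' fun V hV a ↦ ?_
    obtain ⟨a, rfl⟩ := trunc_surjective h a
    change (g * g').induced π h V hV _ = g.induced π h V hV (g'.induced π h V hV _)
    rw [GAut.induced_trunc, GAut.induced_trunc, GAut.induced_trunc, GAut.on_mul]

/-- The defining property of `ρ`. -/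
theorem GAut.rho_on {n m : ℕ} (h : m ≤ n) {U V : C.Opens} (g : GAut π n U) (hV : V ≤ U)
    (a : A π n V) :
    (GAut.rho π h U g).on V hV (trunc π h V a) = trunc π h V (g.on V hV a) :=
  g.induced_trunc π h hV a

/-- The morphism of sheaves of groups `ρ : 𝒢_n → 𝒢_m`, for `m ≤ n`. -/
def ρ {n m : ℕ} (h : m ≤ n) : 𝒢 π n ⟶ 𝒢 π m :=
  ⟨{ app := fun U ↦ GrpCat.ofHom (GAut.rho π h U.unop)
     naturality := fun _ _ _ ↦ rfl }⟩

/-! ### The sheaf of groups `T_C ⊕ 𝒪_C` -/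

/-- `T_C(U)`: the `ℂ`-derivations of the sheaf of `ℂ`-algebras `𝒪_C|_U` into itself, that is, the
homomorphisms `Ω_C|_U → 𝒪_C|_U`. -/
@[ext]
structure Tan (U : C.Opens) : Type where
  /-- the derivation of `𝒪_C(V)`, for `V ≤ U` -/
  on : ∀ V : C.Opens, V ≤ U → Derivation ℂ (Reg π V) (Reg π V)
  res_on : ∀ {V W : C.Opens} (h : V ≤ U) (h' : W ≤ V) (a : Reg π V),
    res π h' (on V h a) = on W (h'.trans h) (res π h' a)

theorem Tan.ext' {U : C.Opens} {D D' : Tan π U} (H : ∀ V h a, D.on V h a = D'.on V h a) :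
    D = D' :=
  Tan.ext (funext fun V ↦ funext fun h ↦ Derivation.ext (H V h))

/-- The addition of vector fields. -/
instance (U : C.Opens) : Add (Tan π U) where
  add D D' :=
    { on V h := D.on V h + D'.on V h
      res_on h h' a := by simp [D.res_on, D'.res_on] }

instance (U : C.Opens) : Zero (Tan π U) where
  zero := { on V h := 0, res_on h h' a := by simp }

instance (U : C.Opens) : Neg (Tan π U) where
  neg D := { on V h := -D.on V h, res_on h h' a := by simp [D.res_on] }

instance (U : C.Opens) : AddCommGroup (Tan π U) where
  add_assoc D D' D'' := Tan.ext' π fun V h a ↦ add_assoc (D.on V h a) _ _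
  zero_add D := Tan.ext' π fun V h a ↦ zero_add (D.on V h a)
  add_zero D := Tan.ext' π fun V h a ↦ add_zero (D.on V h a)
  neg_add_cancel D := Tan.ext' π fun V h a ↦ neg_add_cancel (D.on V h a)
  add_comm D D' := Tan.ext' π fun V h a ↦ add_comm (D.on V h a) _
  nsmul := nsmulRec
  zsmul := zsmulRec

/-- Multiplication of vector fields by functions. -/
instance (U : C.Opens) : SMul (Reg π U) (Tan π U) where
  smul θ D :=
    { on V h := res π h θ • D.on V h
      res_on h h' a := by simp [D.res_on, res_res] }

/-- The restriction `T_C(U) → T_C(V)` for `V ≤ U`. -/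
def Tan.restrict {U V : C.Opens} (h : V ≤ U) : Tan π U →+ Tan π V where
  toFun D :=
    { on W h' := D.on W (h'.trans h)
      res_on h' := D.res_on (h'.trans h) }
  map_zero' := rfl
  map_add' _ _ := rfl

/-- `T_C ⊕ 𝒪_C` as a presheaf of groups, the group law being addition. -/
def tanSumPresheaf : TopCat.Presheaf GrpCat.{0} C.toPresheafedSpace.carrier where
  obj U := GrpCat.of (Multiplicative (Tan π U.unop × Reg π U.unop))
  map i := GrpCat.ofHom (AddMonoidHom.toMultiplicative
    ((Tan.restrict π i.unop.le).prodMap (res π i.unop.le : _ →+ _)))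
  map_id _ := GrpCat.hom_ext <| MonoidHom.ext fun x ↦
    congrArg (fun y ↦ Multiplicative.ofAdd ((Multiplicative.toAdd x).1, y))
      (res_self π (Multiplicative.toAdd x).2)
  map_comp i j := GrpCat.hom_ext <| MonoidHom.ext fun x ↦
    congrArg (fun y ↦ Multiplicative.ofAdd (Tan.restrict π (i ≫ j).unop.le
      (Multiplicative.toAdd x).1, y)) (res_res π _ _ (Multiplicative.toAdd x).2).symm

theorem tanSumPresheaf_isSheaf : (tanSumPresheaf π).IsSheaf := by
  rw [TopCat.Presheaf.isSheaf_iff_isSheafUniqueGluing]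
  intro ι W sf hsf
  let D (i : ι) : Tan π (W i) := (Multiplicative.toAdd (sf i)).1
  let β (i : ι) : Reg π (W i) := (Multiplicative.toAdd (sf i)).2
  have cptD (i j : ι) : Tan.restrict π inf_le_left (D i) =
      Tan.restrict π (inf_le_right : W i ⊓ W j ≤ W j) (D j) :=
    congrArg (fun x ↦ (Multiplicative.toAdd x).1) (hsf i j)
  have cptβ (i j : ι) : res π inf_le_left (β i) =
      res π (inf_le_right : W i ⊓ W j ≤ W j) (β j) :=
    congrArg (fun x ↦ (Multiplicative.toAdd x).2) (hsf i j)
  obtain ⟨b, hb⟩ := reg_glue π (V := iSup W) W (le_iSup W) le_rfl β fun i j Z hi hj ↦ by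
    rw [← res_res π inf_le_left (le_inf hi hj), cptβ, res_res]
  have key := glue_end (F := Reg π) (fun h ↦ res π h) (res_res π) (reg_ext π) (reg_glue π) W
    (fun i Z h ↦ (D i).on Z h) (fun i Z Z' h h' a ↦ (D i).res_on h h' a)
    (fun i j Z hi hj a ↦
      congrArg (fun g : Tan π (W i ⊓ W j) ↦ g.on Z (le_inf hi hj) a) (cptD i j))
  choose E hE using key
  have aext {V : C.Opens} (hV : V ≤ iSup W) {a b : Reg π V}
      (h : ∀ i Z (_ : Z ≤ W i) (hZ : Z ≤ V), res π hZ a = res π hZ b) : a = b :=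
    reg_ext π (fun i ↦ V ⊓ W i) (fun i ↦ inf_le_left)
      (by rw [← inf_iSup_eq]; exact le_inf le_rfl hV) fun i ↦ h i _ inf_le_right _
  let G (V : {V : C.Opens // V ≤ iSup W}) : Derivation ℂ (Reg π V.1) (Reg π V.1) :=
    Derivation.mk'
      { toFun := E V.1 V.2
        map_add' a b := aext V.2 fun i Z hi hZ ↦ by
          rw [map_add, hE V.1 V.2 i Z hi hZ, hE V.1 V.2 i Z hi hZ, hE V.1 V.2 i Z hi hZ,
            map_add, map_add]
        map_smul' c a := aext V.2 fun i Z hi hZ ↦ by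
          rw [RingHom.id_apply, map_smul, hE V.1 V.2 i Z hi hZ, hE V.1 V.2 i Z hi hZ,
            map_smul, Derivation.map_smul] }
      fun a b ↦ aext V.2 fun i Z hi hZ ↦ by
        simp only [LinearMap.coe_mk, AddHom.coe_mk, smul_eq_mul, map_add, map_mul]
        rw [hE V.1 V.2 i Z hi hZ, hE V.1 V.2 i Z hi hZ, hE V.1 V.2 i Z hi hZ, map_mul,
          Derivation.leibniz, smul_eq_mul, smul_eq_mul]
  have hG (V : {V : C.Opens // V ≤ iSup W}) (i : ι) (Z : C.Opens) (hi : Z ≤ W i) (hZ : Z ≤ V.1)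
      (a : Reg π V.1) : res π hZ (G V a) = (D i).on Z hi (res π hZ a) :=
    hE V.1 V.2 i Z hi hZ a
  have hGT (V V' : {V : C.Opens // V ≤ iSup W}) (h : V'.1 ≤ V.1) (a : Reg π V.1) :
      res π h (G V a) = G V' (res π h a) := by
    refine aext V'.2 fun i Z hi hZ ↦ ?_
    rw [res_res, hG V i Z hi, hG V' i Z hi, res_res]
  let T : Tan π (iSup W) := ⟨fun V h ↦ G ⟨V, h⟩, fun h h' a ↦ hGT ⟨_, h⟩ ⟨_, h'.trans h⟩ h' a⟩
  have hT (i : ι) : Tan.restrict π (le_iSup W i) T = D i := by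
    refine Tan.ext' π fun V h a ↦ ?_
    have := hG ⟨V, h.trans (le_iSup W i)⟩ i V h le_rfl a
    rwa [res_self, res_self] at this
  refine ⟨Multiplicative.ofAdd (T, b), fun i ↦ ?_, fun s hs ↦ ?_⟩
  · exact congrArg Multiplicative.ofAdd (Prod.ext (hT i) (hb i))
  · let s' : Tan π (iSup W) × Reg π (iSup W) := Multiplicative.toAdd s
    have h1 (i : ι) : Tan.restrict π (le_iSup W i) s'.1 = D i :=
      congrArg (fun x ↦ (Multiplicative.toAdd x).1) (hs i)
    have h2 (i : ι) : res π (le_iSup W i) s'.2 = β i :=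
      congrArg (fun x ↦ (Multiplicative.toAdd x).2) (hs i)
    refine congrArg Multiplicative.ofAdd (Prod.ext (x := s') ?_ ?_)
    · refine Tan.ext' π fun V h a ↦ aext h fun i Z hi hZ ↦ ?_
      refine Eq.trans ?_ (hG ⟨V, h⟩ i Z hi hZ a).symm
      rw [s'.1.res_on]
      exact congrArg (fun g : Tan π (W i) ↦ g.on Z hi (res π hZ a)) (h1 i)
    · exact reg_ext π W (le_iSup W) le_rfl fun i ↦ by rw [h2, hb]

/-- The sheaf of groups `T_C ⊕ 𝒪_C` on `C`. -/
def tanSum : TopCat.Sheaf GrpCat.{0} C.toPresheafedSpace.carrier :=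
  ⟨tanSumPresheaf π, tanSumPresheaf_isSheaf π⟩

/-- The group homomorphism `T_C(U) ⊕ 𝒪_C(U) → 𝒢_n(U)` given by a morphism of sheaves of groups
`T_C ⊕ 𝒪_C → 𝒢_n`. -/
def sec {n : ℕ} (lam : tanSum π ⟶ 𝒢 π n) (U : C.Opens) :
    Multiplicative (Tan π U × Reg π U) →* GAut π n U :=
  (lam.hom.app (op U)).hom

/-! ### The automorphisms `φ_{μν}` -/

/-- `g = φ_{μν}` relative to the vector field `σ` on `U`: for every open `V ⊆ U`,
`g(α) = ∑ₖ (1/k!) σᵏ(α) (μt)ᵏ` for `α ∈ 𝒪_C(V)`, and `g(t) = νt`.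
The powers `tᵏ` with `k ≥ n` vanish, and only the classes of `μ`, `ν` modulo `t^(n-1)` matter. -/
def IsPhi {n : ℕ} {U : C.Opens} (σ : Tan π U) (μ ν : A π n U) (g : GAut π n U) : Prop :=
  ∀ (V : C.Opens) (h : V ≤ U),
    (∀ α : Reg π V, g.on V h (incl π n V α) =
      ∑ k ∈ Finset.range n, ((k.factorial : ℂ)⁻¹) •
        (incl π n V ((σ.on V h)^[k] α) * (resA π n h μ * t π n V) ^ k)) ∧
    g.on V h (t π n V) = resA π n h ν * t π n V

/-- `φ_{μν}` is uniquely determined by `σ`, `μ`, `ν`. -/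
theorem IsPhi.unique {n : ℕ} {U : C.Opens} {σ : Tan π U} {μ ν : A π n U} {g g' : GAut π n U}
    (hg : IsPhi π σ μ ν g) (hg' : IsPhi π σ μ ν g') : g = g' := by
  refine GAut.ext' fun V h a ↦ ?_
  have : (g.on V h).toAlgHom.toRingHom = (g'.on V h).toAlgHom.toRingHom :=
    ringHom_ext (fun α ↦ ((hg V h).1 α).trans ((hg' V h).1 α).symm)
      ((hg V h).2.trans (hg' V h).2.symm)
  exact congrArg (fun f ↦ f a) this

end

end PrimitiveCurves

namespace PrimitiveCurves

noncomputable section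

variable {C : Scheme.{0}} {π : C ⟶ Spec (CommRingCat.of ℂ)} {n : ℕ} {U V : C.Opens}

/-! ### The top power of `t` -/

theorem t_mul_t_pow (hn : n ≠ 0) : t π n V * t π n V ^ (n - 1) = 0 := by
  rw [← pow_succ', Nat.sub_add_cancel (by omega), t_pow]

theorem t_pow_mul_t_pow (hn : n ≠ 0) {k : ℕ} (hk : k ≠ 0) :
    t π n V ^ k * t π n V ^ (n - 1) = 0 := by
  obtain ⟨k, rfl⟩ := Nat.exists_eq_succ_of_ne_zero hk
  rw [pow_succ, mul_assoc, t_mul_t_pow hn, mul_zero]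

theorem incl_mul_t_pow_injective (hn : n ≠ 0) {a b : Reg π V}
    (h : incl π n V a * t π n V ^ (n - 1) = incl π n V b * t π n V ^ (n - 1)) : a = b := by
  rw [← sub_eq_zero, ← sub_mul, ← map_sub] at h
  have h' : AdjoinRoot.mk (X ^ n : (Reg π V)[X]) (Polynomial.C (a - b) * X ^ (n - 1)) = 0 := by
    simpa using h
  have := X_pow_dvd_iff.1 (AdjoinRoot.mk_eq_zero.1 h') (n - 1) (by omega)
  rw [coeff_C_mul_X_pow, if_pos rfl] at this
  exact sub_eq_zero.1 this

/-- The kernel of `𝒜_n → 𝒜_{n-1}` is `𝒪_C t^(n-1)`. -/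
theorem exists_eq_incl_mul_t_pow (hn : n ≠ 0) {a : A π n V}
    (h : trunc π (Nat.sub_le n 1) V a = 0) : ∃ c, a = incl π n V c * t π n V ^ (n - 1) := by
  obtain ⟨b, rfl⟩ := Ideal.mem_span_singleton.1 ((trunc_eq_zero_iff _ _).1 h)
  have h0 : aug π hn V (b - incl π n V (aug π hn V b)) = 0 := by simp [aug]
  obtain ⟨d, hd⟩ := Ideal.mem_span_singleton.1 ((aug_eq_zero_iff hn _).1 h0)
  refine ⟨aug π hn V b, ?_⟩
  linear_combination t π n V ^ (n - 1) * hd + d * t_mul_t_pow (π := π) (V := V) hn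

theorem trunc_incl_mul_t_pow (c : Reg π V) :
    trunc π (Nat.sub_le n 1) V (incl π n V c * t π n V ^ (n - 1)) = 0 := by
  rw [map_mul, map_pow, trunc_t, t_pow, mul_zero]

theorem add_mul_t_pow_pow (hn : 3 ≤ n) (b : A π n V) :
    (t π n V + b * t π n V ^ (n - 1)) ^ (n - 1) = t π n V ^ (n - 1) := by
  have e : t π n V + b * t π n V ^ (n - 1) = t π n V * (1 + b * t π n V ^ (n - 2)) := by
    rw [show n - 1 = n - 2 + 1 by omega]; ring
  have key (k : ℕ) :
      t π n V ^ (n - 1) * (1 + b * t π n V ^ (n - 2)) ^ k = t π n V ^ (n - 1) := by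
    induction k with
    | zero => simp
    | succ k ih =>
      rw [pow_succ, ← mul_assoc, ih]
      linear_combination b * t_pow_mul_t_pow (π := π) (V := V) (n := n) (k := n - 2)
        (by omega) (by omega)
  rw [e, mul_pow, key]

theorem add_mul_t_pow_pow_self (hn : 3 ≤ n) (b : A π n V) :
    (t π n V + b * t π n V ^ (n - 1)) ^ n = 0 := by
  rw [← pow_sub_one_mul (by omega), add_mul_t_pow_pow hn, mul_comm, add_mul, mul_assoc,
    t_mul_t_pow (by omega), t_pow_mul_t_pow (by omega) (by omega), mul_zero, add_zero]

/-! ### The automorphisms that are trivial modulo `t ^ (n - 1)` -/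

/-- The homomorphism `α ↦ α + D(α) t^(n-1)` from `𝒪_C(V)` to `𝒜_n(V)`. -/
def infHom (hn : 3 ≤ n) (D : Derivation ℂ (Reg π V) (Reg π V)) : Reg π V →ₐ[ℂ] A π n V where
  toFun a := incl π n V a + incl π n V (D a) * t π n V ^ (n - 1)
  map_one' := by simp
  map_zero' := by simp
  map_add' a b := by simp only [map_add]; ring
  map_mul' a b := by
    simp only [map_mul, Derivation.leibniz, smul_eq_mul, map_add]
    linear_combination (-incl π n V (D a) * incl π n V (D b)) *
      t_pow_mul_t_pow (π := π) (V := V) (n := n) (k := n - 1) (by omega) (by omega)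
  commutes' c := by
    simp only [Derivation.map_algebraMap, map_zero, zero_mul, add_zero]
    rfl

/-- The endomorphism `α ↦ α + D(α) t^(n-1)`, `t ↦ t + β t^(n-1)` of `𝒜_n(V)`. -/
def infEnd (hn : 3 ≤ n) (D : Derivation ℂ (Reg π V) (Reg π V)) (β : Reg π V) :
    A π n V →ₐ[ℂ] A π n V :=
  AdjoinRoot.liftAlgHom _ (infHom hn D) (t π n V + incl π n V β * t π n V ^ (n - 1)) (by
    rw [eval₂_pow, eval₂_X, add_mul_t_pow_pow_self hn])

theorem infEnd_incl (hn : 3 ≤ n) (D : Derivation ℂ (Reg π V) (Reg π V)) (β a : Reg π V) :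
    infEnd hn D β (incl π n V a) = incl π n V a + incl π n V (D a) * t π n V ^ (n - 1) :=
  AdjoinRoot.liftAlgHom_of ..

theorem infEnd_t (hn : 3 ≤ n) (D : Derivation ℂ (Reg π V) (Reg π V)) (β : Reg π V) :
    infEnd hn D β (t π n V) = t π n V + incl π n V β * t π n V ^ (n - 1) :=
  AdjoinRoot.liftAlgHom_root ..

theorem infEnd_incl_mul_t_pow (hn : 3 ≤ n) (D : Derivation ℂ (Reg π V) (Reg π V))
    (β a : Reg π V) : infEnd hn D β (incl π n V a * t π n V ^ (n - 1)) =
      incl π n V a * t π n V ^ (n - 1) := by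
  rw [map_mul, map_pow, infEnd_incl, infEnd_t, add_mul_t_pow_pow hn, add_mul, mul_assoc,
    t_pow_mul_t_pow (by omega) (by omega), mul_zero, add_zero]

theorem algHom_ext {R : Type*} [CommRing R] [Algebra ℂ R] {f g : A π n V →ₐ[ℂ] R}
    (h₁ : ∀ a, f (incl π n V a) = g (incl π n V a)) (h₂ : f (t π n V) = g (t π n V)) :
    f = g :=
  AlgHom.coe_ringHom_injective (ringHom_ext h₁ h₂)

theorem infEnd_comp (hn : 3 ≤ n) (D D' : Derivation ℂ (Reg π V) (Reg π V)) (β β' : Reg π V) :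
    (infEnd hn D β).comp (infEnd hn D' β') = infEnd hn (D + D') (β + β') := by
  refine algHom_ext (fun a ↦ ?_) ?_
  · rw [AlgHom.comp_apply, infEnd_incl, map_add, infEnd_incl_mul_t_pow, infEnd_incl, infEnd_incl,
      Derivation.add_apply, map_add]
    ring
  · rw [AlgHom.comp_apply, infEnd_t, map_add, infEnd_incl_mul_t_pow, infEnd_t, infEnd_t, map_add]
    ring

theorem infEnd_zero (hn : 3 ≤ n) :
    infEnd hn (0 : Derivation ℂ (Reg π V) (Reg π V)) 0 = AlgHom.id ℂ _ :=
  algHom_ext (fun a ↦ by rw [infEnd_incl]; simp) (by rw [infEnd_t]; simp)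

/-- The automorphism `α ↦ α + D(α) t^(n-1)`, `t ↦ t + β t^(n-1)` of `𝒜_n(V)`. -/
def infAut (hn : 3 ≤ n) (D : Derivation ℂ (Reg π V) (Reg π V)) (β : Reg π V) :
    A π n V ≃ₐ[ℂ] A π n V :=
  AlgEquiv.ofAlgHom (infEnd hn D β) (infEnd hn (-D) (-β))
    (by rw [infEnd_comp, add_neg_cancel, add_neg_cancel, infEnd_zero])
    (by rw [infEnd_comp, neg_add_cancel, neg_add_cancel, infEnd_zero])

theorem trunc_infEnd (hn : 3 ≤ n) (D : Derivation ℂ (Reg π V) (Reg π V)) (β : Reg π V)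
    (a : A π n V) : trunc π (Nat.sub_le n 1) V (infEnd hn D β a) =
      trunc π (Nat.sub_le n 1) V a := by
  have : (trunc π (Nat.sub_le n 1) V).comp (infEnd hn D β) = trunc π (Nat.sub_le n 1) V :=
    algHom_ext
      (fun a ↦ by rw [AlgHom.comp_apply, infEnd_incl, map_add, trunc_incl_mul_t_pow, add_zero])
      (by rw [AlgHom.comp_apply, infEnd_t, map_add, trunc_incl_mul_t_pow, add_zero])
  exact congrArg (fun f ↦ f a) this

theorem aug_eq_of_trunc_eq (hn : n - 1 ≠ 0) (hn' : n ≠ 0) {a b : A π n V}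
    (h : trunc π (Nat.sub_le n 1) V a = trunc π (Nat.sub_le n 1) V b) :
    aug π hn' V a = aug π hn' V b := by
  rw [← aug_trunc (Nat.sub_le n 1) hn' hn, h, aug_trunc]

/-- The section of `𝒢_n` given by a vector field `D` and a function `β`. -/
def infGAut (hn : 3 ≤ n) (D : Tan π U) (β : Reg π U) : GAut π n U where
  on V h := infAut hn (D.on V h) (res π h β)
  resA_on {V W} h h' a := by
    have : (resA π n h').comp (infEnd hn (D.on V h) (res π h β)) =
        (infEnd hn (D.on W (h'.trans h)) (res π (h'.trans h) β)).comp (resA π n h') :=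
      algHom_ext
        (fun a ↦ by
          rw [AlgHom.comp_apply, AlgHom.comp_apply, infEnd_incl, resA_incl, infEnd_incl, map_add,
            map_mul, map_pow, resA_incl, resA_incl, resA_t, D.res_on])
        (by
          rw [AlgHom.comp_apply, AlgHom.comp_apply, infEnd_t, resA_t, infEnd_t, map_add,
            map_mul, map_pow, resA_incl, resA_t, res_res])
    exact congrArg (fun f ↦ f a) this
  aug_on {V} h hn' a := aug_eq_of_trunc_eq (by omega) hn' (trunc_infEnd hn _ _ a)

theorem infGAut_on (hn : 3 ≤ n) (D : Tan π U) (β : Reg π U) (h : V ≤ U) (a : A π n V) :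
    (infGAut hn D β).on V h a = infEnd hn (D.on V h) (res π h β) a := rfl

theorem infGAut_mul (hn : 3 ≤ n) (D D' : Tan π U) (β β' : Reg π U) :
    infGAut hn (D + D') (β + β') = infGAut hn D β * infGAut hn D' β' := by
  refine GAut.ext' fun V h a ↦ ?_
  rw [GAut.on_mul, infGAut_on, infGAut_on, infGAut_on, ← AlgHom.comp_apply, infEnd_comp, map_add]
  rfl

variable (π) in
/-- The homomorphism `T_C(U) ⊕ 𝒪_C(U) → 𝒢_n(U)`. -/
def infHomGAut (hn : 3 ≤ n) (U : C.Opens) : Multiplicative (Tan π U × Reg π U) →* GAut π n U :=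
  MonoidHom.mk' (fun x ↦ infGAut hn (Multiplicative.toAdd x).1 (Multiplicative.toAdd x).2)
    fun _ _ ↦ infGAut_mul hn ..

variable (π) in
/-- The morphism of sheaves of groups `λ : T_C ⊕ 𝒪_C → 𝒢_n`. -/
def lambda (hn : 3 ≤ n) : tanSum π ⟶ 𝒢 π n :=
  ⟨{ app := fun U ↦ GrpCat.ofHom (infHomGAut π hn U.unop)
     naturality := fun U V i ↦ GrpCat.hom_ext <| MonoidHom.ext fun x ↦
      GAut.ext' (g := infGAut hn _ _) (g' := GAut.restrict π n i.unop.le (infGAut hn _ _))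
        fun W h a ↦ by
          change infEnd hn _ (res π h (res π i.unop.le (Multiplicative.toAdd x).2)) a =
            infEnd hn _ (res π (h.trans i.unop.le) (Multiplicative.toAdd x).2) a
          rw [res_res]
          rfl }⟩

theorem sec_lambda (hn : 3 ≤ n) (D : Tan π U) (β : Reg π U) :
    sec π (lambda π hn) U (Multiplicative.ofAdd (D, β)) = infGAut hn D β := rfl

theorem isPhi_infGAut (hn : 3 ≤ n) (σ : Tan π U) (θ β : Reg π U) :
    IsPhi π σ (incl π n U θ * t π n U ^ (n - 2)) (1 + incl π n U β * t π n U ^ (n - 2))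
      (infGAut hn (θ • σ) β) := by
  intro V h
  have e : t π n V ^ (n - 2) * t π n V = t π n V ^ (n - 1) := by
    rw [← pow_succ]; congr 1; omega
  constructor
  · intro α
    rw [infGAut_on, infEnd_incl, map_mul, map_pow, resA_incl, resA_t, mul_assoc, e]
    obtain ⟨m, rfl⟩ : ∃ m, n = m + 2 := ⟨n - 2, by omega⟩
    rw [Finset.sum_range_succ', Finset.sum_range_succ', Finset.sum_eq_zero fun k _ ↦ ?_]
    · change _ + incl π _ V (res π h θ * σ.on V h α) * _ = _
      simp only [zero_add, Function.iterate_one, Function.iterate_zero, id, pow_one, pow_zero,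
        mul_one, Nat.factorial_one, Nat.factorial_zero, Nat.cast_one, inv_one, one_smul, map_mul]
      ring
    · rw [pow_add _ k 2, mul_pow _ _ 2, sq (t π (m + 2) V ^ _),
        t_pow_mul_t_pow (by omega) (by omega)]
      simp
  · rw [infGAut_on, infEnd_t, map_add, map_one, map_mul, map_pow, resA_incl, resA_t, ← e]
    ring

theorem infGAut_injective (hn : 3 ≤ n) {D D' : Tan π U} {β β' : Reg π U}
    (h : infGAut hn D β = infGAut hn D' β') : D = D' ∧ β = β' := by
  have h' (V hV) (a) : (infGAut hn D β).on V hV a = (infGAut hn D' β').on V hV a := by rw [h]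
  refine ⟨Tan.ext' π fun V hV a ↦ ?_, ?_⟩
  · have := h' V hV (incl π n V a)
    rw [infGAut_on, infGAut_on, infEnd_incl, infEnd_incl] at this
    exact incl_mul_t_pow_injective (by omega) (add_left_cancel this)
  · have := h' U le_rfl (t π n U)
    rw [infGAut_on, infGAut_on, infEnd_t, infEnd_t, res_self, res_self] at this
    exact incl_mul_t_pow_injective (by omega) (add_left_cancel this)

theorem mem_ker_rho {m : ℕ} (h : m ≤ n) {g : GAut π n U} : g ∈ (GAut.rho π h U).ker ↔
    ∀ V hV a, trunc π h V (g.on V hV a) = trunc π h V a := by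
  rw [MonoidHom.mem_ker]
  constructor
  · intro H V hV a
    rw [← GAut.rho_on, H]
    rfl
  · intro H
    refine GAut.ext' fun V hV a ↦ ?_
    obtain ⟨a, rfl⟩ := trunc_surjective h a
    rw [GAut.rho_on, H]
    rfl

theorem infGAut_mem_ker (hn : 3 ≤ n) (D : Tan π U) (β : Reg π U) :
    infGAut hn D β ∈ (GAut.rho π (Nat.sub_le n 1) U).ker :=
  (mem_ker_rho _).2 fun _ _ _ ↦ trunc_infEnd hn _ _ _

theorem exists_derivation (hn : 3 ≤ n) (f : Reg π V →ₐ[ℂ] A π n V)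
    (hf : ∀ a, trunc π (Nat.sub_le n 1) V (f a) = incl π _ V a) :
    ∃ D : Derivation ℂ (Reg π V) (Reg π V),
      ∀ a, f a = incl π n V a + incl π n V (D a) * t π n V ^ (n - 1) := by
  have (a : Reg π V) : ∃ c, f a - incl π n V a = incl π n V c * t π n V ^ (n - 1) :=
    exists_eq_incl_mul_t_pow (by omega) (by rw [map_sub, hf, trunc_incl, sub_self])
  choose c hc using this
  have hc' (a) : f a = incl π n V a + incl π n V (c a) * t π n V ^ (n - 1) := by
    rw [← hc]; ring
  have tt := t_pow_mul_t_pow (π := π) (V := V) (n := n) (k := n - 1) (by omega) (by omega)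
  refine ⟨Derivation.mk' { toFun := c, map_add' := fun a b ↦ ?_, map_smul' := fun r a ↦ ?_ }
    fun a b ↦ ?_, hc'⟩ <;> refine incl_mul_t_pow_injective (n := n) (by omega) ?_
  · rw [← hc, map_add, map_add, map_add, add_mul, ← hc, ← hc]; ring
  · have e (x : Reg π V) : incl π n V (r • x) = r • incl π n V x :=
      map_smul (AdjoinRoot.ofAlgHom ℂ (X ^ n : (Reg π V)[X])) r x
    rw [← hc, map_smul, RingHom.id_apply, e, e, smul_mul_assoc, ← hc, smul_sub]
  · change incl π n V (c (a * b)) * _ = incl π n V (a * c b + b * c a) * _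
    rw [← hc, map_mul, hc', hc']
    simp only [map_mul, map_add]
    linear_combination (incl π n V (c a) * incl π n V (c b)) * tt

theorem exists_eq_infGAut (hn : 3 ≤ n) {g : GAut π n U}
    (hg : g ∈ (GAut.rho π (Nat.sub_le n 1) U).ker) :
    ∃ (D : Tan π U) (β : Reg π U), g = infGAut hn D β := by
  rw [mem_ker_rho] at hg
  choose D hD using fun (V : C.Opens) (hV : V ≤ U) ↦
    exists_derivation hn ((g.on V hV).toAlgHom.comp (AdjoinRoot.ofAlgHom ℂ _))
      fun a ↦ (hg V hV _).trans (trunc_incl _ a)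
  obtain ⟨β, hβ⟩ : ∃ β, g.on U le_rfl (t π n U) - t π n U =
      incl π n U β * t π n U ^ (n - 1) :=
    exists_eq_incl_mul_t_pow (by omega) (by rw [map_sub, hg, sub_self])
  have hD' (V hV) (a : Reg π V) : g.on V hV (incl π n V a) =
      incl π n V a + incl π n V (D V hV a) * t π n V ^ (n - 1) := hD V hV a
  refine ⟨⟨D, fun {V W} h h' a ↦ incl_mul_t_pow_injective (n := n) (by omega) ?_⟩, β,
    GAut.ext' fun V hV a ↦ ?_⟩
  · have := g.resA_on h h' (incl π n V a)
    rw [resA_incl, hD', hD', map_add, map_mul, map_pow, resA_incl, resA_incl, resA_t] at this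
    exact add_left_cancel this
  · have : (g.on V hV).toAlgHom = infEnd hn (D V hV) (res π hV β) := by
      refine algHom_ext (fun a ↦ (hD' V hV a).trans (infEnd_incl ..).symm) ?_
      rw [infEnd_t]
      have := g.resA_on le_rfl hV (t π n U)
      rw [resA_t, sub_eq_iff_eq_add'.1 hβ, map_add, map_mul, map_pow, resA_incl, resA_t] at this
      exact this.symm
    exact congrArg (fun f ↦ f a) this

/-! ### Smooth algebras of sections over affine open sets -/

variable (π) in
theorem formallySmooth_reg [Smooth π] (hV : IsAffineOpen V) :
    Algebra.FormallySmooth ℂ (Reg π V) := by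
  have h1 : (π.appLE ⊤ V le_top).hom.Smooth := π.smooth_appLE (isAffineOpen_top _) hV le_top
  have h2 : (Scheme.ΓSpecIso (CommRingCat.of ℂ)).inv.hom.Smooth :=
    RingHom.Smooth.of_bijective (ConcreteCategory.bijective_of_isIso _)
  have h3 : (algebraMap ℂ (Reg π V)).Smooth := h2.comp h1
  rw [RingHom.smooth_algebraMap] at h3
  infer_instance

variable (π) in
/-- The basic open set of `f`. -/
def basic (f : Reg π V) : C.Opens := C.basicOpen (show Γ(C, V) from f)

theorem basic_le (f : Reg π V) : basic π f ≤ V := C.basicOpen_le _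

theorem isUnit_res_basic (f : Reg π V) : IsUnit (res π (basic_le f) f) :=
  RingedSpace.isUnit_res_basicOpen _ _

theorem exists_basic_le (hV : IsAffineOpen V) {W : C.Opens} (hW : W ≤ V) {x : C} (hx : x ∈ W) :
    ∃ f : Reg π V, basic π f ≤ W ∧ x ∈ basic π f :=
  hV.exists_basicOpen_le ⟨x, hx⟩ (hW hx)

theorem ringHom_basic_ext (hV : IsAffineOpen V) {f : Reg π V} {R : Type*} [CommRing R]
    {φ ψ : Reg π (basic π f) →+* R}
    (h : ∀ a, φ (res π (basic_le f) a) = ψ (res π (basic_le f) a)) : φ = ψ := by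
  have := hV.isLocalization_basicOpen f
  exact @IsLocalization.ringHom_ext Γ(C, V) _ (.powers (show Γ(C, V) from f))
    Γ(C, C.basicOpen (show Γ(C, V) from f)) _ _ _ R _ φ ψ (RingHom.ext h)

theorem exists_ringHom_basic (hV : IsAffineOpen V) (f : Reg π V) {R : Type*} [CommRing R]
    (φ : Reg π V →+* R) (hf : IsUnit (φ f)) :
    ∃ ψ : Reg π (basic π f) →+* R, ∀ a, ψ (res π (basic_le f) a) = φ a := by
  have := hV.isLocalization_basicOpen f
  exact ⟨IsLocalization.Away.lift (S := Γ(C, C.basicOpen (show Γ(C, V) from f)))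
    (show Γ(C, V) from f) hf, IsLocalization.Away.lift_eq
      (S := Γ(C, C.basicOpen (show Γ(C, V) from f))) (show Γ(C, V) from f) hf⟩

theorem isUnit_of_isUnit_aug (hn : n ≠ 0) {a : A π n V} (h : IsUnit (aug π hn V a)) :
    IsUnit a := by
  have h0 : aug π hn V (a - incl π n V (aug π hn V a)) = 0 := by simp [aug]
  obtain ⟨d, hd⟩ := Ideal.mem_span_singleton.1 ((aug_eq_zero_iff hn _).1 h0)
  rw [sub_eq_iff_eq_add'.1 hd]
  refine IsNilpotent.isUnit_add_left_of_commute ⟨n, ?_⟩ (h.map _) (Commute.all _ _)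
  rw [mul_pow, t_pow, zero_mul]

/-- A homomorphism `𝒪_C(V) → 𝒜_n(V)` with `V` affine that is a section of the projection extends
to a morphism of sheaves. -/
theorem exists_sheafHom (hn : n ≠ 0) (hV : IsAffineOpen V) (φ : Reg π V →+* A π n V)
    (hφ : ∀ a, aug π hn V (φ a) = a) :
    ∃ E : ∀ W : C.Opens, W ≤ V → (Reg π W →+* A π n W),
      (∀ W hW a, E W hW (res π hW a) = resA π n hW (φ a)) ∧
      ∀ W W' (hW : W ≤ V) (h : W' ≤ W) a, resA π n h (E W hW a) = E W' (h.trans hW) (res π h a) := by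
  have key (f : Reg π V) : ∃ ψ : Reg π (basic π f) →+* A π n (basic π f),
      ∀ a, ψ (res π (basic_le f) a) = resA π n (basic_le f) (φ a) :=
    exists_ringHom_basic hV f ((resA π n (basic_le f)).toRingHom.comp φ) <|
      isUnit_of_isUnit_aug hn <| by
        change IsUnit (aug π hn _ (resA π n _ _))
        rw [aug_resA, hφ]
        exact isUnit_res_basic f
  choose Ψ hΨ using key
  have compat (f g : Reg π V) (h : basic π g ≤ basic π f) (a : Reg π (basic π f)) :
      resA π n h (Ψ f a) = Ψ g (res π h a) := by
    have : (resA π n h).toRingHom.comp (Ψ f) = (Ψ g).comp (res π h).toRingHom :=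
      ringHom_basic_ext hV fun a ↦ by
        change resA π n h (Ψ f _) = Ψ g (res π h _)
        rw [hΨ, res_res, hΨ, resA_resA]
    exact congrArg (fun f ↦ f a) this
  let ι (W : C.Opens) : Type := {f : Reg π V // basic π f ≤ W}
  have cov {W : C.Opens} (hW : W ≤ V) : W ≤ ⨆ i : ι W, basic π i.1 := fun x hx ↦ by
    obtain ⟨f, hf, hx'⟩ := exists_basic_le (π := π) hV hW hx
    exact Opens.mem_iSup.2 ⟨⟨f, hf⟩, hx'⟩
  have ext {W : C.Opens} (hW : W ≤ V) {a b : A π n W}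
      (h : ∀ f (hf : basic π f ≤ W), resA π n hf a = resA π n hf b) : a = b :=
    A_ext _ (fun i : ι W ↦ i.2) (cov hW) fun i ↦ h i.1 i.2
  have glue (W : C.Opens) (hW : W ≤ V) (a : Reg π W) : ∃ b : A π n W,
      ∀ f (hf : basic π f ≤ W), resA π n hf b = Ψ f (res π hf a) := by
    obtain ⟨b, hb⟩ := A_glue _ (fun i : ι W ↦ i.2) (cov hW) (fun i ↦ Ψ i.1 (res π i.2 a))
      fun i j Z hi hj ↦ ext (hi.trans (i.2.trans hW)) fun g hg ↦ by
        rw [resA_resA, resA_resA, compat, compat, res_res, res_res]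
    exact ⟨b, fun f hf ↦ hb ⟨f, hf⟩⟩
  choose E hE using glue
  refine ⟨fun W hW ↦
    { toFun := E W hW
      map_one' := ext hW fun f hf ↦ by rw [hE]; simp
      map_zero' := ext hW fun f hf ↦ by rw [hE]; simp
      map_add' := fun a b ↦ ext hW fun f hf ↦ by rw [map_add, hE, hE, hE, map_add, map_add]
      map_mul' := fun a b ↦ ext hW fun f hf ↦ by rw [map_mul, hE, hE, hE, map_mul, map_mul] },
    fun W hW a ↦ ext hW fun f hf ↦ ?_, fun W W' hW h a ↦ ext (h.trans hW) fun f hf ↦ ?_⟩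
  · change resA π n hf (E W hW _) = _
    rw [hE, res_res, hΨ, resA_resA]
  · change resA π n hf (resA π n h (E W hW _)) = resA π n hf (E W' _ _)
    rw [resA_resA, hE, hE, res_res]

/-- Morphisms of sheaves of rings on an affine open set are determined by the global sections. -/
theorem sheafHom_ext (hV : IsAffineOpen V) {E E' : ∀ W : C.Opens, W ≤ V → (Reg π W →+* A π n W)}
    (hE : ∀ W W' (hW : W ≤ V) (h : W' ≤ W) a,
      resA π n h (E W hW a) = E W' (h.trans hW) (res π h a))
    (hE' : ∀ W W' (hW : W ≤ V) (h : W' ≤ W) a,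
      resA π n h (E' W hW a) = E' W' (h.trans hW) (res π h a))
    (H : ∀ a, E V le_rfl a = E' V le_rfl a) {W : C.Opens} (hW : W ≤ V) (a : Reg π W) :
    E W hW a = E' W hW a := by
  refine A_ext (fun f : {f : Reg π V // basic π f ≤ W} ↦ basic π f.1) (fun i ↦ i.2)
    (fun x hx ↦ ?_) fun ⟨f, hf⟩ ↦ ?_
  · obtain ⟨f, hf, hx'⟩ := exists_basic_le (π := π) hV hW hx
    exact Opens.mem_iSup.2 ⟨⟨f, hf⟩, hx'⟩
  · have : E _ (basic_le f) = E' _ (basic_le f) := ringHom_basic_ext hV fun a ↦ by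
      rw [← hE V _ le_rfl, ← hE' V _ le_rfl, H]
    rw [hE, hE']
    exact congrArg (fun φ ↦ φ (res π hf a)) this

/-! ### Lifting sections of `𝒢_{n-1}` -/

/-- An endomorphism of `𝒜_n(V)` that is trivial modulo `t^(n-1)` is bijective. -/
theorem bijective_of_trunc_eq (hn : 3 ≤ n) (e : A π n V →+* A π n V)
    (he : ∀ a, trunc π (Nat.sub_le n 1) V (e a) = trunc π (Nat.sub_le n 1) V a) :
    Function.Bijective e := by
  have ht : e (t π n V ^ (n - 1)) = t π n V ^ (n - 1) := by
    obtain ⟨c, hc⟩ := exists_eq_incl_mul_t_pow (a := e (t π n V) - t π n V) (by omega)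
      (by rw [map_sub, he, sub_self])
    rw [map_pow, sub_eq_iff_eq_add'.1 hc, add_mul_t_pow_pow hn]
  have fix (a : A π n V) (ha : trunc π (Nat.sub_le n 1) V a = 0) : e a = a := by
    obtain ⟨c, rfl⟩ := exists_eq_incl_mul_t_pow (by omega) ha
    obtain ⟨d, hd⟩ := exists_eq_incl_mul_t_pow (a := e (incl π n V c) - incl π n V c) (by omega)
      (by rw [map_sub, he, sub_self])
    rw [map_mul, ht, sub_eq_iff_eq_add'.1 hd, add_mul, mul_assoc (incl π n V d),
      t_pow_mul_t_pow (by omega) (by omega), mul_zero, add_zero]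
  constructor
  · refine (injective_iff_map_eq_zero e).2 fun a ha ↦ ?_
    rw [← fix a (by rw [← he, ha, map_zero]), ha]
  · intro b
    have := fix (e b - b) (by rw [map_sub, he, sub_self])
    refine ⟨2 * b - e b, ?_⟩
    rw [map_sub] at this
    rw [map_sub, map_mul, map_ofNat]
    linear_combination -this

/-- Over an affine open set, a section of `𝒢_{n-1}` lifts to an endomorphism of `𝒜_n`. -/
theorem exists_lift_end [Smooth π] (hn : 3 ≤ n) (hV : IsAffineOpen V) (g : GAut π (n - 1) V) :
    ∃ e : ∀ W : C.Opens, W ≤ V → (A π n W →+* A π n W),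
      (∀ W W' (hW : W ≤ V) (h : W' ≤ W) a,
        resA π n h (e W hW a) = e W' (h.trans hW) (resA π n h a)) ∧
      (∀ W hW a, trunc π (Nat.sub_le n 1) W (e W hW a) =
        g.on W hW (trunc π (Nat.sub_le n 1) W a)) ∧
      ∀ W hW c, e W hW (algebraMap ℂ _ c) = algebraMap ℂ _ c := by
  have := formallySmooth_reg π hV
  have hn0 : n ≠ 0 := by omega
  have hn1 : n - 1 ≠ 0 := by omega
  let f : Reg π V →ₐ[ℂ] A π (n - 1) V :=
    (g.on V le_rfl).toAlgHom.comp (AdjoinRoot.ofAlgHom ℂ _)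
  have nil : IsNilpotent (RingHom.ker (trunc π (Nat.sub_le n 1) V)) := by
    have : RingHom.ker (trunc π (Nat.sub_le n 1) V) = Ideal.span {t π n V ^ (n - 1)} :=
      Ideal.ext fun a ↦ trunc_eq_zero_iff _ a
    refine ⟨2, ?_⟩
    rw [this, Ideal.span_singleton_pow, sq, t_pow_mul_t_pow hn0 hn1]
    exact Ideal.span_singleton_eq_bot.2 rfl
  let φ := Algebra.FormallySmooth.liftOfSurjective f _ (trunc_surjective (Nat.sub_le n 1)) nil
  have hφ (a) : trunc π (Nat.sub_le n 1) V (φ a) = g.on V le_rfl (incl π _ V a) :=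
    Algebra.FormallySmooth.liftOfSurjective_apply f _ (trunc_surjective (Nat.sub_le n 1)) nil a
  obtain ⟨E, hE, hE'⟩ := exists_sheafHom hn0 hV φ.toRingHom fun a ↦ by
    change aug π hn0 V (φ a) = a
    rw [← aug_trunc (Nat.sub_le n 1) hn0 hn1, hφ, g.aug_on]
    simp [aug]
  have tE {W : C.Opens} (hW : W ≤ V) (a : Reg π W) :
      trunc π (Nat.sub_le n 1) W (E W hW a) = g.on W hW (incl π _ W a) :=
    sheafHom_ext hV (E := fun W hW ↦ (trunc π (Nat.sub_le n 1) W).toRingHom.comp (E W hW))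
      (E' := fun W hW ↦ (g.on W hW).toRingEquiv.toRingHom.comp (incl π _ W))
      (fun W W' hW h a ↦ by
        change resA π _ h (trunc π (Nat.sub_le n 1) W (E W hW a)) =
          trunc π (Nat.sub_le n 1) W' (E W' _ _)
        rw [← trunc_resA, hE'])
      (fun W W' hW h a ↦ (g.resA_on hW h _).trans (by rw [resA_incl]; rfl))
      (fun a ↦ by
        have := hE V le_rfl a
        rw [res_self, resA_self] at this
        exact (congrArg _ this).trans (hφ a)) hW a
  obtain ⟨τ, hτ⟩ := trunc_surjective (Nat.sub_le n 1) (g.on V le_rfl (t π _ V))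
  have τ_pow : τ ^ n = 0 := by
    have : aug π hn0 V τ = 0 := by
      rw [← aug_trunc (Nat.sub_le n 1) hn0 hn1, hτ, g.aug_on]
      simp [aug]
    obtain ⟨d, rfl⟩ := Ideal.mem_span_singleton.1 ((aug_eq_zero_iff hn0 _).1 this)
    rw [mul_pow, t_pow, zero_mul]
  let e (W : C.Opens) (hW : W ≤ V) : A π n W →+* A π n W :=
    AdjoinRoot.lift (E W hW) (resA π n hW τ) (by
      rw [eval₂_pow, eval₂_X, ← map_pow, τ_pow, map_zero])
  have e_incl (W hW) (a : Reg π W) : e W hW (incl π n W a) = E W hW a := AdjoinRoot.lift_of _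
  have e_t (W hW) : e W hW (t π n W) = resA π n hW τ := AdjoinRoot.lift_root _
  refine ⟨e, fun W W' hW h a ↦ ?_, fun W hW a ↦ ?_, fun W hW c ↦ ?_⟩
  · have : (resA π n h).toRingHom.comp (e W hW) =
        (e W' (h.trans hW)).comp (resA π n h).toRingHom := by
      refine ringHom_ext (fun a ↦ ?_) ?_
      · change resA π n h (e W hW _) = e W' _ (resA π n h _)
        rw [e_incl, resA_incl, e_incl, hE']
      · change resA π n h (e W hW _) = e W' _ (resA π n h _)
        rw [e_t, resA_t, e_t, resA_resA]
    exact congrArg (fun f ↦ f a) this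
  · have : (trunc π (Nat.sub_le n 1) W).toRingHom.comp (e W hW) =
        (g.on W hW).toRingEquiv.toRingHom.comp (trunc π (Nat.sub_le n 1) W).toRingHom := by
      refine ringHom_ext (fun a ↦ ?_) ?_
      · change trunc π (Nat.sub_le n 1) W (e W hW _) = g.on W hW (trunc π (Nat.sub_le n 1) W _)
        rw [e_incl, tE, trunc_incl]
      · change trunc π (Nat.sub_le n 1) W (e W hW _) = g.on W hW (trunc π (Nat.sub_le n 1) W _)
        rw [e_t, trunc_resA, hτ, g.resA_on, resA_t, trunc_t]
    exact congrArg (fun f ↦ f a) this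
  · have h1 := hE W hW (algebraMap ℂ _ c)
    rw [AlgHom.commutes] at h1
    refine (e_incl W hW (algebraMap ℂ _ c)).trans (h1.trans ?_)
    exact ((resA π n hW).comp φ).commutes c

theorem bijective_of_comp {α : Type*} {f g : α → α} (h : Function.Bijective (f ∘ g))
    (h' : Function.Bijective (g ∘ f)) : Function.Bijective f :=
  ⟨h'.1.of_comp, h.2.of_comp⟩

/-- Over an affine open set, a section of `𝒢_{n-1}` lifts to a section of `𝒢_n`. -/
theorem exists_lift [Smooth π] (hn : 3 ≤ n) (hV : IsAffineOpen V) (g : GAut π (n - 1) V) :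
    ∃ g' : GAut π n V, GAut.rho π (Nat.sub_le n 1) V g' = g := by
  obtain ⟨e, he, het, hec⟩ := exists_lift_end hn hV g
  obtain ⟨e', -, het', -⟩ := exists_lift_end hn hV g⁻¹
  have bij (W hW) : Function.Bijective (e W hW) := by
    refine bijective_of_comp (g := e' W hW)
      (bijective_of_trunc_eq hn ((e W hW).comp (e' W hW)) fun a ↦ ?_)
      (bijective_of_trunc_eq hn ((e' W hW).comp (e W hW)) fun a ↦ ?_)
    · rw [RingHom.comp_apply, het, het']
      exact (g.on W hW).apply_symm_apply _
    · rw [RingHom.comp_apply, het', het]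
      exact (g.on W hW).symm_apply_apply _
  refine ⟨
    { on W hW := AlgEquiv.ofBijective { e W hW with commutes' := hec W hW } (bij W hW)
      resA_on hW h a := he _ _ hW h a
      aug_on {W} hW hn' a := by
        change aug π hn' W (e W hW a) = _
        have hn1 : n - 1 ≠ 0 := by omega
        rw [← aug_trunc (Nat.sub_le n 1) hn' hn1, het, g.aug_on, aug_trunc] }, ?_⟩
  refine GAut.ext' fun W hW a ↦ ?_
  obtain ⟨a, rfl⟩ := trunc_surjective (Nat.sub_le n 1) a
  rw [GAut.rho_on]
  exact het W hW a

theorem isLocallySurjective_rho [Smooth π] (hn : 3 ≤ n) :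
    TopCat.Presheaf.IsLocallySurjective (ρ π (Nat.sub_le n 1)).hom := by
  rw [TopCat.Presheaf.isLocallySurjective_iff]
  intro U g x hx
  obtain ⟨V, hV, hxV, hVU⟩ := exists_isAffineOpen_mem_and_subset hx
  obtain ⟨g', hg'⟩ := exists_lift hn hV (GAut.restrict π (n - 1) hVU g)
  exact ⟨V, hVU, ⟨g', hg'⟩, hxV⟩

end

end PrimitiveCurves

theorem proposition4p4p2 {C : Scheme.{0}} (π : C ⟶ Spec (CommRingCat.of ℂ))
    [SmoothOfRelativeDimension 1 π] (n : ℕ) (hn : 3 ≤ n) :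
    -- the kernel of `ρ_n` is abelian
    (∀ (U : C.Opens), ∀ g ∈ (PrimitiveCurves.GAut.rho π (Nat.sub_le n 1) U).ker,
      ∀ g' ∈ (PrimitiveCurves.GAut.rho π (Nat.sub_le n 1) U).ker, g * g' = g' * g) ∧
    ∃ lam : PrimitiveCurves.tanSum π ⟶ PrimitiveCurves.𝒢 π n,
      -- `lam (θσ, β) = φ_{θt^(n-2), 1+βt^(n-2)}` relative to `σ`
      (∀ (U : C.Opens) (σ : PrimitiveCurves.Tan π U) (θ β : PrimitiveCurves.Reg π U),
        PrimitiveCurves.IsPhi π σ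
          (PrimitiveCurves.incl π n U θ * PrimitiveCurves.t π n U ^ (n - 2))
          (1 + PrimitiveCurves.incl π n U β * PrimitiveCurves.t π n U ^ (n - 2))
          (PrimitiveCurves.sec π lam U (Multiplicative.ofAdd (θ • σ, β)))) ∧
      -- `0 → T_C ⊕ 𝒪_C → 𝒢_n → 𝒢_{n-1} → 0` is exact
      (∀ U : C.Opens, Function.Injective (PrimitiveCurves.sec π lam U)) ∧
      (∀ U : C.Opens, (PrimitiveCurves.sec π lam U).range =
        (PrimitiveCurves.GAut.rho π (Nat.sub_le n 1) U).ker) ∧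
      TopCat.Presheaf.IsLocallySurjective (PrimitiveCurves.ρ π (Nat.sub_le n 1)).hom := by 
  have := SmoothOfRelativeDimension.smooth 1 π
  refine ⟨fun U g hg g' hg' ↦ ?_, PrimitiveCurves.lambda π hn,
    fun U σ θ β ↦ PrimitiveCurves.isPhi_infGAut hn σ θ β, fun U x y h ↦ ?_, fun U ↦ ?_,
    PrimitiveCurves.isLocallySurjective_rho hn⟩
  · obtain ⟨D, β, rfl⟩ := PrimitiveCurves.exists_eq_infGAut hn hg
    obtain ⟨D', β', rfl⟩ := PrimitiveCurves.exists_eq_infGAut hn hg'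
    rw [← PrimitiveCurves.infGAut_mul, add_comm D, add_comm β, PrimitiveCurves.infGAut_mul]
  · obtain ⟨h1, h2⟩ := PrimitiveCurves.infGAut_injective hn h
    exact congrArg Multiplicative.ofAdd (Prod.ext h1 h2)
  · refine le_antisymm ?_ fun g hg ↦ ?_
    · rintro _ ⟨x, rfl⟩
      exact PrimitiveCurves.infGAut_mem_ker hn _ _
    · obtain ⟨D, β, rfl⟩ := PrimitiveCurves.exists_eq_infGAut hn hg
      exact ⟨Multiplicative.ofAdd (D, β), rfl⟩
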